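/- Let $\Gamma$ be a finite undirected graph with vertex set $V$ and edge set $E$ (loops and multiple edges are allowed; $\Gamma$ need not be connected), and let $\mu : V \to (0,\infty)$ be a weighting of the vertices. Let $\vec\Gamma$ be the directed version of $\Gamma$: an edge with endpoints $\alpha\neq\beta$ gives two directed edges $\epsilon,\epsilon^{op}$ with $s(\epsilon)=t(\epsilon^{op})=\alpha$ and $t(\epsilon)=s(\epsilon^{op})=\beta$, and a loop gives one directed loop $\epsilon=\epsilon^{op}$. Let $\mathcal H$ be the Fock space of $\vec\Gamma$, realised as the Hilbert space whose orthonormal basis is the set of all finite paths in $\vec\Gamma$, where the paths of length $0$ are the vertices. For $\alpha\in V$ let $p_\alpha$ be the projection onto the span of the paths starting at $\alpha$. For a directed edge $\epsilon$ let $\ell(\epsilon)$ be the creation operator, which sends a path $q$ to $\epsilon q$ if $q$ starts at $t(\epsilon)$ and to $0$ otherwise, and put $$X_\epsilon = a_\epsilon\,\ell(\epsilon)+a_\epsilon^{-1}\,\ell(\epsilon^{op})^*,\qquad a_\epsilon=\sqrt[4]{\mu(s(\epsilon))/\mu(t(\epsilon))}.$$ Let $\mathcal A\subset B(\mathcal H)$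 be the $*$-algebra generated by all the $p_\alpha$ and $X_\epsilon$, let $\mathrm{Tr}(x)=\sum_{\alpha\in V}\mu(\alpha)\langle \alpha, x\alpha\rangle$, and let $\mathrm{tr}_n$ be the normalised trace on $n\times n$ matrices. Theorem. Let $x\in M_n(\mathcal A)$ be self-adjoint. Then there is a unique finite positive measure $\nu$ on $\mathbb R$ (the law of $x$ with respect to $\mathrm{Tr}\otimes\mathrm{tr}_n$) that is supported on the spectrum of $x$ and satisfies $\int t^k\,d\nu(t)=(\mathrm{Tr}\otimes\mathrm{tr}_n)(x^k)$ for all $k\ge 0$, and its Cauchy transform $G_\nu(z)=\int_{\mathbb R}\frac{d\nu(t)}{z-t}$ is algebraic: for all sufficiently large $|z|$, $G_\nu(z)$ is the sum of a convergent power series $P$ in the variable $1/z$, and $\sum_{j=0}^m Q_jP^j=0$ in $\mathbb C[[1/z]]$ for some $m$ and some $Q_0,\dots,Q_m\in\mathbb C[1/z]$, not all zero. -/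

import Mathlib

open scoped ENNReal

/-- A weighted undirected graph with vertex set `V` and edge set `E`; loops and multiple edges are
allowed.  `ends e` is the unordered pair of endpoints of `e`, and `weight` is the strictly positive
weighting of the vertices. -/
structure WeightedGraph (V E : Type*) where
  ends : E → Sym2 V
  weight : V → ℝ
  weight_pos : ∀ v, 0 < weight v

namespace WeightedGraph

variable {V E : Type*} (Γ : WeightedGraph V E)

/-- The edges of the directed version of `Γ`: an edge with distinct endpoints `a`, `b` gives the two
directed edges `(e, a, b)` and `(e, b, a)`, and a loop at `c` gives the single directed loop
`(e, c, c)`. -/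
structure DirEdge where
  edge : E
  src : V
  tgt : V
  ends_eq : Γ.ends edge = s(src, tgt)

variable {Γ}

/-- The opposite directed edge; a loop is its own opposite. -/
def DirEdge.op (ε : Γ.DirEdge) : Γ.DirEdge where
  edge := ε.edge
  src := ε.tgt
  tgt := ε.src
  ends_eq := ε.ends_eq.trans Sym2.eq_swap

/-- `IsPathFrom v l` says that the list `l` of directed edges is a path starting at `v`. -/
def IsPathFrom : V → List Γ.DirEdge → Prop
  | _, [] => True
  | v, ε :: l => ε.src = v ∧ IsPathFrom ε.tgt l

variable (Γ)

/-- Paths of finite length in the directed version of `Γ`: a starting vertex and a list of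
consecutive directed edges.  The paths of length zero are the vertices. -/
def DirPath : Type _ := {q : V × List Γ.DirEdge // IsPathFrom q.1 q.2}

variable {Γ}

/-- The starting vertex of a path. -/
def DirPath.src (q : Γ.DirPath) : V := q.1.1

/-- The path of length zero at a vertex. -/
def vertexPath (v : V) : Γ.DirPath := ⟨(v, []), trivial⟩

open Classical in
/-- `removeFirst ε q` is the path `q'` if `q` is `ε` followed by the path `q'`, and `none` if `q` does
not start with `ε`. -/
noncomputable def removeFirst (ε : Γ.DirEdge) : Γ.DirPath → Option Γ.DirPath
  | ⟨(_, []), _⟩ => none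
  | ⟨(_, ε' :: l), h⟩ => if ε' = ε then some ⟨(ε'.tgt, l), h.2⟩ else none

open Classical in
/-- `restrictSrc v q` is `q` if `q` starts at `v`, and `none` otherwise. -/
noncomputable def restrictSrc (v : V) (q : Γ.DirPath) : Option Γ.DirPath :=
  if q.src = v then some q else none

theorem removeFirst_inj (ε : Γ.DirEdge) (q r s : Γ.DirPath) (hq : removeFirst ε q = some s)
    (hr : removeFirst ε r = some s) : q = r := by
  rcases q with ⟨⟨a, _ | ⟨d, l⟩⟩, h⟩
  · simp [removeFirst] at hq
  rcases r with ⟨⟨b, _ | ⟨d', l'⟩⟩, h'⟩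
  · simp [removeFirst] at hr
  simp only [removeFirst, Option.ite_none_right_eq_some] at hq hr
  obtain ⟨rfl, hq⟩ := hq
  obtain ⟨rfl, hr⟩ := hr
  have h1 : l = l' := congrArg (fun t => t.1.2) (Option.some.inj (hq.trans hr.symm))
  subst h1
  have h2 : d'.src = a := h.1
  have h3 : d'.src = b := h'.1
  subst h2
  subst h3
  rfl

theorem restrictSrc_inj (v : V) (q r s : Γ.DirPath) (hq : restrictSrc v q = some s)
    (hr : restrictSrc v r = some s) : q = r := by
  simp only [restrictSrc, Option.ite_none_right_eq_some, Option.some.injEq] at hq hr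
  exact hq.2.trans hr.2.symm

theorem sum_pullback_le {ι : Type*} (g : ι → Option ι)
    (hg : ∀ i j k, g i = some k → g j = some k → i = j) (f : lp (fun _ : ι => ℂ) 2)
    (s : Finset ι) :
    ∑ i ∈ s, ‖(g i).elim 0 (fun k => f k)‖ ^ (2 : ℝ≥0∞).toReal ≤ ‖f‖ ^ (2 : ℝ≥0∞).toReal := by
  classical
  refine le_trans (le_of_eq ?_) (lp.sum_rpow_le_norm_rpow (by simp) f
    (s.filterMap g (fun a a' b h h' => hg a a' b h h')))
  refine Finset.sum_bij_ne_zero (fun i _ hi => (g i).get ?_) ?_ ?_ ?_ ?_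
  · by_contra h
    simp only [Option.not_isSome_iff_eq_none] at h
    simp [h] at hi
  · intro i hi h
    simp only [Finset.mem_filterMap]
    exact ⟨i, hi, by simp⟩
  · intro i hi h j hj h' e
    rcases hi' : g i with _ | a
    · simp [hi'] at h
    rcases hj' : g j with _ | b
    · simp [hj'] at h'
    simp only [hi', hj', Option.get_some] at e
    exact hg i j a hi' (e ▸ hj')
  · intro k hk hk'
    simp only [Finset.mem_filterMap] at hk
    obtain ⟨i, hi, hik⟩ := hk
    exact ⟨i, hi, by simpa [hik] using hk', by simp [hik]⟩
  · intro i hi h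
    obtain ⟨k, hk⟩ : ∃ k, g i = some k := by
      rcases hgi : g i with _ | k
      · simp [hgi] at h
      · exact ⟨k, rfl⟩
    simp [hk]

/-- The bounded operator on `ℓ²(ι)` induced by a partially defined injective map `g` of `ι`: it
sends `f` to the function `i ↦ f (g i)`, read as `0` where `g` is undefined. -/
noncomputable def pullback {ι : Type*} (g : ι → Option ι)
    (hg : ∀ i j k, g i = some k → g j = some k → i = j) :
    lp (fun _ : ι => ℂ) 2 →L[ℂ] lp (fun _ : ι => ℂ) 2 :=
  LinearMap.mkContinuous
    { toFun := fun f => ⟨fun i => (g i).elim 0 (fun k => f k), memℓp_gen' (sum_pullback_le g hg f)⟩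
      map_add' := by
        intro f f'
        ext i
        change (g i).elim 0 (fun k => (f + f') k) =
          (g i).elim 0 (fun k => f k) + (g i).elim 0 (fun k => f' k)
        rcases g i with _ | k <;> simp
      map_smul' := by
        intro c f
        ext i
        rcases h : g i with _ | k <;> simp [h] }
    1
    (by
      intro f
      rw [one_mul]
      exact lp.norm_le_of_forall_sum_le (by simp) (norm_nonneg f) (sum_pullback_le g hg f))

variable (Γ)

/-- The Fock space of the directed graph, as a Hilbert space: `ℓ²` of the set of finite paths.  A path
`ε₁ ⋯ εₙ` stands for the elementary tensor `ε₁ ⊗ ⋯ ⊗ εₙ` normalised to have norm one, and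
the path of length zero at `v` for (the normalised vector of) the indicator function of `v`. -/
abbrev Fock : Type _ := lp (fun _ : Γ.DirPath => ℂ) 2

variable {Γ}

/-- The creation operator of a directed edge: it sends a path `q` to the path `ε q` if `q` starts at
the target of `ε`, and to zero otherwise. -/
noncomputable def creation (ε : Γ.DirEdge) : Γ.Fock →L[ℂ] Γ.Fock :=
  pullback (removeFirst ε) (removeFirst_inj ε)

variable (Γ) in
/-- The projection `p_v` onto the span of the paths that start at `v` (the left action of the
indicator function of `v`). -/
noncomputable def vertexProj (v : V) : Γ.Fock →L[ℂ] Γ.Fock :=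
  pullback (restrictSrc v) (restrictSrc_inj v)

/-- `a_ε`, the fourth root of `μ(s(ε)) / μ(t(ε))`; it is `1` for a loop. -/
noncomputable def edgeCoeff (ε : Γ.DirEdge) : ℝ :=
  (Γ.weight ε.src / Γ.weight ε.tgt) ^ (1 / 4 : ℝ)

/-- `X_ε = a_ε ℓ(ε) + a_ε⁻¹ ℓ(ε^op)^*`.  For a loop this is `ℓ(ε) + ℓ(ε)^*`. -/
noncomputable def edgeOp (ε : Γ.DirEdge) : Γ.Fock →L[ℂ] Γ.Fock :=
  (edgeCoeff ε : ℂ) • creation ε +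
    ((edgeCoeff ε)⁻¹ : ℂ) • ContinuousLinearMap.adjoint (creation ε.op)

variable (Γ) in
/-- The `*`-algebra `𝒜` generated by the projections `p_v` and the operators `X_ε`. -/
noncomputable def graphAlgebra : StarSubalgebra ℂ (Γ.Fock →L[ℂ] Γ.Fock) :=
  StarAlgebra.adjoin ℂ (Set.range Γ.vertexProj ∪ Set.range (edgeOp (Γ := Γ)))

open Classical in
variable (Γ) in
/-- The unit vector of the path of length zero at `v`. -/
noncomputable def vertexVec (v : V) : Γ.Fock := lp.single 2 (vertexPath v) (1 : ℂ)

/-- The conditional expectation onto the functions on the vertices: the value of `E(x)` at `v` is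
`⟨p_v | x p_v⟩`. -/
noncomputable def condExp (x : Γ.Fock →L[ℂ] Γ.Fock) (v : V) : ℂ :=
  inner ℂ (Γ.vertexVec v) (x (Γ.vertexVec v))

/-- The trace `Tr = tr ∘ E`, where `tr` is the functional with `tr(p_v) = μ(v)`. -/
noncomputable def graphTrace [Fintype V] (x : Γ.Fock →L[ℂ] Γ.Fock) : ℂ :=
  ∑ v : V, (Γ.weight v : ℂ) * condExp x v

/-- `Tr ⊗ tr_n`, where `tr_n` is the normalised trace of `n × n` matrices. -/
noncomputable def matrixTrace [Fintype V] {n : ℕ}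
    (x : Matrix (Fin n) (Fin n) (Γ.Fock →L[ℂ] Γ.Fock)) : ℂ :=
  (n : ℂ)⁻¹ * ∑ i, graphTrace (x i i)

/-- `ν` is the law of the self-adjoint matrix `x` with respect to `Tr ⊗ tr_n`: a finite positive
measure supported on the spectrum of `x` whose moments are the traces of the powers of `x`. -/
structure IsLaw [Fintype V] {n : ℕ} (x : Matrix (Fin n) (Fin n) (Γ.Fock →L[ℂ] Γ.Fock))
    (ν : MeasureTheory.Measure ℝ) : Prop where
  finite : MeasureTheory.IsFiniteMeasure ν
  support : ν (spectrum ℝ x)ᶜ = 0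
  moment : ∀ k : ℕ, ((∫ t, t ^ k ∂ν : ℝ) : ℂ) = matrixTrace (x ^ k)

end WeightedGraph

/-- The Cauchy transform of a measure on the real line. -/
noncomputable def cauchyTransform (ν : MeasureTheory.Measure ℝ) (z : ℂ) : ℂ :=
  ∫ t : ℝ, (z - (t : ℂ))⁻¹ ∂ν

/-- The Cauchy transform of `ν` is algebraic: near infinity it is given by a convergent power series
`P` in `1/z`, and `P` is algebraic over the polynomials in that variable, that is,
`∑ j, Q j * P ^ j = 0` for some polynomials `Q j`, not all zero. -/
def HasAlgebraicCauchyTransform (ν : MeasureTheory.Measure ℝ) : Prop :=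
  ∃ P : PowerSeries ℂ,
    (∃ R : ℝ, ∀ z : ℂ, R < ‖z‖ →
      HasSum (fun k : ℕ => PowerSeries.coeff k P * z⁻¹ ^ k) (cauchyTransform ν z)) ∧
    IsAlgebraic (Polynomial ℂ) P

/-! The creation operators, their adjoints and the vertex projections act only on the beginning of a
path. A matrix `Y` whose entries are linear in them is therefore a walk on paths with matrix
weights: each step creates a first edge, removes one, or stays put. The series `H s` of the walks
that return to a path with source `s` without ever cutting into it depends on `s` alone. Splitting
off the last excursion gives `H s = 1 + X F_s H s`, where `F_s = c_s + X ∑ b_ε H(s(ε)) a_ε` over the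
edges `ε` ending at `s` (`firstReturn`). The moments of `Y` at a vertex are the coefficients of `H`
(`pow_apply_vertexVec`).

This is a finite polynomial system `u = c + X w(u)` over `ℂ[X]`. Its Jacobian `1 - X J` has a
determinant with constant term `1`, so the differentials of the unknowns over `ℂ(X)` vanish and the
solutions are algebraic (`PowerSeries.isAlgebraic_of_system`).

A general element of the algebra has some finite degree in the steps. A matrix of degree `2 ^ (e +
1)` factors as `a * b` with factors of degree `2 ^ e`; the off-diagonal block matrix with blocks
`a`, `b` has `(a * b) ^ k` as the corner of its even powers and zero there for odd ones. Passing
from a series in `X ^ 2` to the series in `X` preserves algebraicity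
(`PowerSeries.isAlgebraic_of_even`), and induction on `e` reduces everything to degree one.

The law exists by Riesz representation applied to the positive functional `Tr ⊗ tr_n` on the
continuous functional calculus. It is unique because its support is bounded. Its Cauchy transform is
`1/z` times the moment series evaluated at `1/z`. -/

/-! ### Algebraicity of solutions of polynomial systems, by Kähler differentials -/

section Algebraicity

open scoped Polynomial PowerSeries LaurentSeries RatFunc
open KaehlerDifferential

/-- The vector of differentials is killed by the invertible matrix `1 - M`, hence is zero. The
generators then make every differential of `K` over `k` vanish, and a finitely generated field
extension without differentials is separable algebraic. -/
theorem IntermediateField.isAlgebraic_of_linear_kaehler {k L ι : Type*} [Field k] [CharZero k]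
    [Field L] [Algebra k L] [Fintype ι] [DecidableEq ι] (u : ι → L) (K : IntermediateField k L)
    (hK : K = IntermediateField.adjoin k (Set.range u)) (M : Matrix ι ι K)
    (hdet : (1 - M).det ≠ 0) (v : ι → K) (hv : ∀ i, (v i : L) = u i)
    (h : ∀ i, D k K (v i) = ∑ j, M i j • D k K (v j)) (i : ι) :
    IsAlgebraic k (u i) := by
  have h1 : ∀ i, ∑ j, (1 - M) i j • D k K (v j) = 0 := by
    intro i
    simp only [Matrix.sub_apply, sub_smul, Finset.sum_sub_distrib]
    rw [← h i]
    simp [Matrix.one_apply, ite_smul]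
  have h2 : ∀ i, D k K (v i) = 0 := by
    intro i
    have h3 : ∑ l, (1 - M).adjugate i l • ∑ j, (1 - M) l j • D k K (v j) = 0 := by
      simp only [h1, smul_zero, Finset.sum_const_zero]
    simp only [Finset.smul_sum, smul_smul] at h3
    rw [Finset.sum_comm] at h3
    simp only [← Finset.sum_smul, ← Matrix.mul_apply, Matrix.adjugate_mul] at h3
    have h4 : (1 - M).det • D k K (v i) = 0 := by
      simpa only [Matrix.smul_apply, Matrix.one_apply, ite_smul, smul_ite, smul_zero, zero_smul,
        smul_eq_mul, mul_one, mul_zero, mul_ite, ite_smul, Finset.sum_ite_eq, Finset.mem_univ, if_true] using h3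
    exact (smul_eq_zero.1 h4).resolve_left hdet
  have h4 : ∀ y : K, D k K y = 0 := by
    rintro ⟨y, hyK⟩
    have hy := hyK
    rw [hK] at hy
    have hle : IntermediateField.adjoin k (Set.range u) ≤ K := hK.ge
    induction hy using IntermediateField.adjoin_induction with
    | mem x hx =>
      obtain ⟨i, rfl⟩ := hx
      rw [← h2 i]
      congr 1
      exact Subtype.ext (hv i).symm
    | algebraMap x => exact (D k K).map_algebraMap x
    | add x y hx hy hx' hy' =>
      have := (D k K).map_add ⟨x, hle hx⟩ ⟨y, hle hy⟩
      rw [hx', hy', add_zero] at this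
      exact this
    | inv x hx hx' =>
      have := (D k K).leibniz_inv ⟨x, hle hx⟩
      rw [hx', smul_zero] at this
      exact this
    | mul x y hx hy hx' hy' =>
      have := (D k K).leibniz ⟨x, hle hx⟩ ⟨y, hle hy⟩
      rw [hx', hy', smul_zero, smul_zero, add_zero] at this
      exact this
  have h5 : Algebra.FormallyUnramified k K := by
    refine ⟨subsingleton_of_forall_eq 0 fun w => ?_⟩
    have hw : w ∈ Submodule.span K (Set.range (D k K)) := by
      rw [KaehlerDifferential.span_range_derivation]; trivial
    have : Set.range (D k K) ⊆ {0} := by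
      rintro _ ⟨y, rfl⟩
      exact h4 y
    have := Submodule.span_mono (R := K) this hw
    simpa using this
  have h6 : Algebra.EssFiniteType k K :=
    IntermediateField.essFiniteType_iff.2 (hK ▸ IntermediateField.fg_adjoin_of_finite (Set.finite_range u))
  have h7 := Algebra.FormallyUnramified.isSeparable k K
  have h8 : IsAlgebraic k (v i) := (Algebra.IsSeparable.isIntegral k (v i)).isAlgebraic
  rw [← hv i]
  exact h8.algebraMap

/-- Differentiating `u = c + t w(u)` over `k`, where `c` and `t` are constants, gives `du = t J du`
with `J` the Jacobian of `w`. The ring `O` keeps the entries of `J` integral, so that a determinant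
`det (1 - t J)` can be tested there. -/
theorem isAlgebraic_of_differential_system {R O k L ι : Type*} [CommRing R] [CommRing O] [Field k]
    [CharZero k] [Field L] [Algebra R O] [Algebra R k] [Algebra R L] [Algebra O L] [Algebra k L]
    [IsScalarTower R k L] [IsScalarTower R O L] [Fintype ι] [DecidableEq ι]
    (hinj : Function.Injective (algebraMap O L)) (u w : ι → O) (c : ι → R) (t : R)
    (hw : ∀ i, w i ∈ Algebra.adjoin R (Set.range u))
    (hu : ∀ i, u i = algebraMap R O (c i) + algebraMap R O t * w i)
    (hdet : ∀ s : Matrix ι ι O, (1 - algebraMap R O t • s).det ≠ 0) (i : ι) :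
    IsAlgebraic k (algebraMap O L (u i)) := by
  set φ := algebraMap O L with hφ
  set U : ι → L := fun i => φ (u i) with hU
  obtain ⟨K, hK⟩ : ∃ K, K = IntermediateField.adjoin k (Set.range U) := ⟨_, rfl⟩
  have hmem : ∀ i, U i ∈ K := fun i => hK ▸ IntermediateField.subset_adjoin _ _ ⟨i, rfl⟩
  let v : ι → K := fun i => ⟨U i, hmem i⟩
  let ψ : R → K := fun r => algebraMap k K (algebraMap R k r)
  have hψ : ∀ r, algebraMap K L (ψ r) = φ (algebraMap R O r) := by
    intro p
    rw [← IsScalarTower.algebraMap_apply k K L, ← IsScalarTower.algebraMap_apply, hφ,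
      ← IsScalarTower.algebraMap_apply]
  have hDψ : ∀ r, D k K (ψ r) = 0 := fun r => Derivation.map_algebraMap _ _
  -- The chain rule, with `m` a row of partial derivatives. The lifts `s` of its entries to `O` are
  -- carried along because `hdet` speaks of matrices over `O`.
  have key : ∀ y ∈ Algebra.adjoin R (Set.range u), ∃ (a : K) (m : ι → K) (s : ι → O),
      algebraMap K L a = φ y ∧ (∀ j, algebraMap K L (m j) = φ (s j)) ∧
        D k K a = ∑ j, m j • D k K (v j) := by
    intro y hy
    induction hy using Algebra.adjoin_induction with
    | mem x hx =>
      obtain ⟨i, rfl⟩ := hx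
      refine ⟨v i, Pi.single i 1, Pi.single i 1, rfl, ?_, ?_⟩
      · intro j
        by_cases hij : j = i
        · subst hij; simp
        · simp [hij]
      · simp [Pi.single_apply, ite_smul]
    | algebraMap r => exact ⟨ψ r, 0, 0, hψ r, by simp, by simp [hDψ]⟩
    | add x y hx hy hx' hy' =>
      obtain ⟨a, m, s, h1, h2, h3⟩ := hx'
      obtain ⟨a', m', s', h1', h2', h3'⟩ := hy'
      refine ⟨a + a', m + m', s + s', by rw [map_add, map_add, h1, h1'], fun j => ?_, ?_⟩
      · rw [Pi.add_apply, Pi.add_apply, map_add, map_add, h2, h2']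
      · simp only [map_add, h3, h3', Pi.add_apply, add_smul, Finset.sum_add_distrib]
    | mul x y hx hy hx' hy' =>
      obtain ⟨a, m, s, h1, h2, h3⟩ := hx'
      obtain ⟨a', m', s', h1', h2', h3'⟩ := hy'
      refine ⟨a * a', fun j => a * m' j + a' * m j, fun j => x * s' j + y * s j,
        by rw [map_mul, map_mul, h1, h1'], fun j => ?_, ?_⟩
      · simp only [map_add, map_mul, h1, h1', h2, h2']
      · simp only [Derivation.leibniz, h3, h3', add_smul, Finset.sum_add_distrib, Finset.smul_sum,
          smul_smul]
  choose a m s h1 h2 h3 using fun i => key (w i) (hw i)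
  have hv : ∀ i, v i = ψ (c i) + ψ t * a i := by
    intro i
    apply (algebraMap K L).injective
    rw [map_add, map_mul, hψ, hψ, h1, ← map_mul, ← map_add, ← hu]
    rfl
  refine IntermediateField.isAlgebraic_of_linear_kaehler U K hK (ψ t • Matrix.of m) ?_ v
    (fun _ => rfl) (fun i => ?_) i
  · intro h0
    apply hdet (Matrix.of s)
    apply hinj
    rw [map_zero, RingHom.map_det]
    have := congrArg (algebraMap K L) h0
    rw [map_zero, RingHom.map_det] at this
    rw [← this]
    congr 1
    ext1 i j
    simp only [RingHom.mapMatrix_apply, Matrix.map_apply, Matrix.sub_apply, Matrix.smul_apply,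
      Matrix.of_apply, smul_eq_mul, map_sub, map_mul, h2, hψ]
    congr 1
    by_cases hij : i = j <;> simp [Matrix.one_apply, hij]
  · conv_lhs => rw [hv i]
    rw [map_add, Derivation.leibniz, hDψ, hDψ, h3, zero_add, smul_zero, add_zero, Finset.smul_sum]
    simp [smul_smul]

theorem PowerSeries.isAlgebraic_of_system {ι : Type*} [Finite ι] (u w : ι → ℂ⟦X⟧) (c : ι → ℂ[X])
    (hw : ∀ i, w i ∈ Algebra.adjoin ℂ[X] (Set.range u))
    (hu : ∀ i, u i = algebraMap ℂ[X] ℂ⟦X⟧ (c i) + PowerSeries.X * w i) (i : ι) :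
    IsAlgebraic ℂ[X] (u i) := by
  classical
  have := Fintype.ofFinite ι
  have : IsScalarTower ℂ[X] ℂ⟦X⟧ ℂ⸨X⸩ := IsScalarTower.of_algebraMap_eq' rfl
  have hinj : Function.Injective (algebraMap ℂ⟦X⟧ ℂ⸨X⸩) := IsFractionRing.injective ℂ⟦X⟧ ℂ⸨X⸩
  have hX : algebraMap ℂ[X] ℂ⟦X⟧ Polynomial.X = PowerSeries.X := Polynomial.coe_X
  have alg := isAlgebraic_of_differential_system (k := RatFunc ℂ) hinj u w c Polynomial.X hw
    (by rwa [hX]) ?_ i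
  · rw [← IsFractionRing.isAlgebraic_iff ℂ[X] (RatFunc ℂ) ℂ⸨X⸩] at alg
    exact (isAlgebraic_algebraMap_iff hinj).1 alg
  -- Modulo `X` the matrix `1 - X s` is the identity, so its determinant has constant coefficient
  -- `1`.
  · intro s e1
    rw [hX] at e1
    have e2 := congrArg PowerSeries.constantCoeff e1
    rw [map_zero, RingHom.map_det] at e2
    have e3 : (PowerSeries.constantCoeff (R := ℂ)).mapMatrix
        (1 - (PowerSeries.X : ℂ⟦X⟧) • s) = 1 := by
      ext1 i j
      by_cases hij : i = j <;> simp [Matrix.one_apply, hij]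
    rw [e3, Matrix.det_one] at e2
    exact one_ne_zero e2

end Algebraicity

/-! ### Algebraicity under the substitution of `X ^ 2` for `X` -/

section EvenPart

open scoped Polynomial PowerSeries

theorem PowerSeries.sum_antidiagonal_even (f g : ℂ⟦X⟧)
    (h0 : ∀ k, coeff (2 * k) g = coeff k f) (h1 : ∀ k, coeff (2 * k + 1) g = 0)
    (h : ℂ⟦X⟧) {r : ℕ} (hr : r < 2) (k : ℕ) :
    coeff (2 * k + r) (h * g) = ∑ p ∈ Finset.HasAntidiagonal.antidiagonal k, coeff (2 * p.1 + r) h * coeff p.2 f := by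
  rw [coeff_mul]
  symm
  refine Finset.sum_of_injOn (fun p => (2 * p.1 + r, 2 * p.2)) ?_ ?_ ?_ ?_
  · intro p _ q _ hpq
    simp only [Prod.mk.injEq] at hpq
    ext <;> omega
  · intro p hp
    simp only [Finset.mem_coe, Finset.HasAntidiagonal.mem_antidiagonal] at hp ⊢
    omega
  · rintro ⟨a, b⟩ hab hnot
    simp only [Finset.HasAntidiagonal.mem_antidiagonal] at hab
    rcases Nat.even_or_odd' b with ⟨c, rfl | rfl⟩
    · refine absurd ⟨(k - c, c), ?_, ?_⟩ hnot
      · simp; omega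
      · simp; omega
    · simp [h1]
  · intro p _
    simp [h0]

/-- Here `g = f(X ^ 2)`. In a polynomial relation for `g` the even and the odd powers of `X` cancel
separately, since the powers of `g` are even; each parity class is a relation for `f`, and one of
the two is nontrivial. -/
theorem PowerSeries.isAlgebraic_of_even (f g : ℂ⟦X⟧)
    (h0 : ∀ k, coeff (2 * k) g = coeff k f) (h1 : ∀ k, coeff (2 * k + 1) g = 0)
    (hg : IsAlgebraic ℂ[X] g) : IsAlgebraic ℂ[X] f := by
  obtain ⟨Q, hQ, hQg⟩ := hg
  -- The parity parts, normalised by `q = (e 0 q)(X ^ 2) + X * (e 1 q)(X ^ 2)`. The summation range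
  -- may exceed the degree of `e r q`, where the coefficients are zero.
  let e : ℕ → ℂ[X] → ℂ[X] := fun r q =>
    ∑ k ∈ Finset.range (q.natDegree + 1), Polynomial.C (q.coeff (2 * k + r)) * Polynomial.X ^ k
  have he : ∀ r q k, (e r q).coeff k = q.coeff (2 * k + r) := by
    intro r q k
    simp only [e, Polynomial.finsetSum_coeff, Polynomial.coeff_C_mul_X_pow, Finset.sum_ite_eq,
      Finset.mem_range]
    split_ifs with hk
    · rfl
    · rw [Polynomial.coeff_eq_zero_of_natDegree_lt (by omega)]
  have hpow : ∀ j, (∀ k, coeff (2 * k) (g ^ j) = coeff k (f ^ j)) ∧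
      ∀ k, coeff (2 * k + 1) (g ^ j) = 0 := by
    intro j
    induction j with
    | zero =>
      refine ⟨fun k => ?_, fun k => ?_⟩ <;> simp [coeff_one]
    | succ j ih =>
      refine ⟨fun k => ?_, fun k => ?_⟩
      · have := sum_antidiagonal_even f g h0 h1 (g ^ j) (r := 0) (by norm_num) k
        rw [add_zero] at this
        rw [pow_succ, pow_succ, this, coeff_mul]
        simp [ih.1]
      · rw [pow_succ, sum_antidiagonal_even f g h0 h1 (g ^ j) (r := 1) (by norm_num) k]
        simp [ih.2]
  have hsum : ∀ r < 2, ∑ j ∈ Finset.range (Q.natDegree + 1),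
      algebraMap ℂ[X] ℂ⟦X⟧ (e r (Q.coeff j)) * f ^ j = 0 := by
    intro r hr
    ext k
    rw [Polynomial.aeval_eq_sum_range] at hQg
    have := congrArg (coeff (2 * k + r)) hQg
    rw [map_sum, map_zero] at this
    rw [map_sum, map_zero, ← this]
    refine Finset.sum_congr rfl fun j _ => ?_
    rw [Algebra.smul_def, sum_antidiagonal_even (f ^ j) (g ^ j) (hpow j).1 (hpow j).2 _ hr, coeff_mul]
    refine Finset.sum_congr rfl fun p _ => ?_
    congr 1
    change coeff p.1 ((e r (Q.coeff j) : ℂ[X]) : ℂ⟦X⟧) = coeff _ ((Q.coeff j : ℂ[X]) : ℂ⟦X⟧)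
    rw [Polynomial.coeff_coe, Polynomial.coeff_coe, he]
  obtain ⟨j, hj⟩ : ∃ j, Q.coeff j ≠ 0 := by
    by_contra! hc
    exact hQ (Polynomial.ext hc)
  obtain ⟨i, hi⟩ : ∃ i, (Q.coeff j).coeff i ≠ 0 := by
    by_contra! hc
    exact hj (Polynomial.ext hc)
  -- The parity of a surviving exponent `i` selects the relation that is nonzero.
  have hr : i % 2 < 2 := Nat.mod_lt _ (by norm_num)
  refine ⟨∑ j ∈ Finset.range (Q.natDegree + 1),
    Polynomial.C (e (i % 2) (Q.coeff j)) * Polynomial.X ^ j, ?_, ?_⟩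
  · intro hz
    have := congrArg (fun p => (p.coeff j).coeff (i / 2)) hz
    simp only [Polynomial.finsetSum_coeff, Polynomial.coeff_C_mul_X_pow, Finset.sum_ite_eq,
      Finset.mem_range] at this
    rw [if_pos (Nat.lt_succ_of_le (Polynomial.le_natDegree_of_ne_zero hj)), he,
      Nat.div_add_mod] at this
    exact hi (by simpa using this)
  · simpa using hsum _ hr

end EvenPart

/-! ### A contraction principle for the `X`-adic topology -/

section FixedPoint

open scoped PowerSeries

/-- Each application of `T` gains one order of agreement, so the iterates of `0` converge
coefficientwise. -/
theorem PowerSeries.exists_fixedPoint {ι : Type*} (T : (ι → ℂ⟦X⟧) → ι → ℂ⟦X⟧)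
    (hT : ∀ m u w, (∀ i, X ^ m ∣ u i - w i) → ∀ i, X ^ (m + 1) ∣ T u i - T w i) :
    ∃ u, T u = u := by
  let a : ℕ → ι → ℂ⟦X⟧ := fun m => T^[m] 0
  have ha : ∀ m, a (m + 1) = T (a m) := fun m => Function.iterate_succ_apply' T m 0
  have h1 : ∀ m i, X ^ m ∣ a (m + 1) i - a m i := by
    intro m
    induction m with
    | zero => simp
    | succ m ih =>
      rw [ha (m + 1)]
      nth_rw 2 [ha m]
      exact hT m _ _ ih
  have h2 : ∀ m d i, X ^ m ∣ a (m + d) i - a m i := by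
    intro m d i
    induction d with
    | zero => simp
    | succ d ih =>
      have := dvd_add ((pow_dvd_pow X (Nat.le_add_right m d)).trans (h1 (m + d) i)) ih
      rwa [sub_add_sub_cancel] at this
  -- The coefficient of degree `k` no longer changes from the iterate `k + 1` on.
  let u : ι → ℂ⟦X⟧ := fun i => mk fun k => coeff k (a (k + 1) i)
  have h3 : ∀ m i, X ^ m ∣ u i - a m i := by
    intro m i
    rw [X_pow_dvd_iff]
    intro k hk
    obtain ⟨d, rfl⟩ := Nat.exists_eq_add_of_lt hk
    have := X_pow_dvd_iff.1 (h2 (k + 1) d i) k (Nat.lt_succ_self k)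
    rw [show k + 1 + d = k + d + 1 by ring] at this
    rw [map_sub] at this ⊢
    rw [coeff_mk, sub_eq_zero]
    exact (sub_eq_zero.1 this).symm
  refine ⟨u, funext fun i => sub_eq_zero.1 ?_⟩
  ext k
  have h4 : X ^ (k + 1) ∣ T u i - u i := by
    have e1 := (pow_dvd_pow X (Nat.le_succ _)).trans (hT (k + 1) u (a (k + 1)) (h3 (k + 1)) i)
    have e2 := (pow_dvd_pow X (Nat.le_succ _)).trans (h3 (k + 1 + 1) i)
    rw [ha] at e2
    have := dvd_sub e1 e2
    rwa [sub_sub_sub_cancel_right] at this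
  exact X_pow_dvd_iff.1 h4 k (Nat.lt_succ_self k)

end FixedPoint

/-! ### Creation, annihilation and vertex projections in coordinates -/

namespace WeightedGraph

variable {V E : Type*} {Γ : WeightedGraph V E}

section Operators

theorem pullback_apply {ι : Type*} (g : ι → Option ι)
    (hg : ∀ i j k, g i = some k → g j = some k → i = j) (f : lp (fun _ : ι => ℂ) 2) (i : ι) :
    pullback g hg f i = (g i).elim 0 (fun k => f k) := rfl

open Classical in
theorem adjoint_pullback_apply_of_eq_some {ι : Type*} (g : ι → Option ι)
    (hg : ∀ i j k, g i = some k → g j = some k → i = j) (f : lp (fun _ : ι => ℂ) 2) {i k : ι}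
    (hi : g i = some k) : ContinuousLinearMap.adjoint (pullback g hg) f k = f i := by
  have h1 : pullback g hg (lp.single 2 k (1 : ℂ)) = lp.single 2 i (1 : ℂ) := by
    ext j
    rw [pullback_apply, lp.single_apply, Pi.single_apply]
    rcases hj : g j with _ | l
    · rw [if_neg (by rintro rfl; simp [hi] at hj)]
      rfl
    · rw [Option.elim_some, lp.single_apply, Pi.single_apply]
      refine if_congr ⟨?_, ?_⟩ rfl rfl
      · rintro rfl; exact hg _ _ _ hj hi
      · rintro rfl; exact Option.some.inj (hj.symm.trans hi)
  have h2 := ContinuousLinearMap.adjoint_inner_right (pullback g hg) (lp.single 2 k (1 : ℂ)) f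
  rw [h1, lp.inner_single_left, lp.inner_single_left] at h2
  simpa using h2

open Classical in
theorem adjoint_pullback_apply_of_forall_ne {ι : Type*} (g : ι → Option ι)
    (hg : ∀ i j k, g i = some k → g j = some k → i = j) (f : lp (fun _ : ι => ℂ) 2) {k : ι}
    (hk : ∀ i, g i ≠ some k) : ContinuousLinearMap.adjoint (pullback g hg) f k = 0 := by
  have h1 : pullback g hg (lp.single 2 k (1 : ℂ)) = 0 := by
    ext j
    rw [pullback_apply]
    rcases hj : g j with _ | l
    · rfl
    · rw [Option.elim_some, lp.single_apply, Pi.single_apply, if_neg]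
      · rfl
      · rintro rfl; exact hk _ hj
  have h2 := ContinuousLinearMap.adjoint_inner_right (pullback g hg) (lp.single 2 k (1 : ℂ)) f
  rw [h1, lp.inner_single_left, inner_zero_left] at h2
  simpa using h2

/-- The path that starts with the edge `ε` and continues with a given path. -/
def DirPath.cons (ε : Γ.DirEdge) (q : Γ.DirPath) (h : q.src = ε.tgt) : Γ.DirPath :=
  ⟨(ε.src, ε :: q.1.2), rfl, by have := q.2; rwa [show q.1.1 = ε.tgt from h] at this⟩

theorem removeFirst_cons (ε : Γ.DirEdge) (q : Γ.DirPath) (h : q.src = ε.tgt) :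
    removeFirst ε (q.cons ε h) = some q := by
  obtain ⟨⟨s, l⟩, hq⟩ := q
  obtain rfl : s = ε.tgt := h
  simp [removeFirst, DirPath.cons]

theorem src_of_removeFirst {ε : Γ.DirEdge} {q r : Γ.DirPath} (h : removeFirst ε q = some r) :
    r.src = ε.tgt := by
  rcases q with ⟨⟨a, _ | ⟨d, l⟩⟩, hq⟩
  · simp [removeFirst] at h
  · simp only [removeFirst, Option.ite_none_right_eq_some] at h
    obtain ⟨rfl, h⟩ := h
    rw [← Option.some.inj h]
    rfl

theorem DirPath.eq_vertexPath_or_eq_cons (q : Γ.DirPath) :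
    (∃ s, q = vertexPath s) ∨ ∃ (ε : Γ.DirEdge) (r : Γ.DirPath) (h : r.src = ε.tgt),
      q = r.cons ε h := by
  obtain ⟨⟨s, _ | ⟨ε, l⟩⟩, hq⟩ := q
  · exact Or.inl ⟨s, rfl⟩
  · obtain ⟨h1, h2⟩ := hq
    change ε.src = s at h1
    subst h1
    exact Or.inr ⟨ε, ⟨(ε.tgt, l), h2⟩, rfl, rfl⟩

theorem creation_apply_vertexPath (ε : Γ.DirEdge) (f : Γ.Fock) (s : V) :
    creation ε f (vertexPath s) = 0 := rfl

open Classical in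
theorem creation_apply_cons (ε ε' : Γ.DirEdge) (f : Γ.Fock) (q : Γ.DirPath) (h : q.src = ε'.tgt) :
    creation ε f (q.cons ε' h) = if ε' = ε then f q else 0 := by
  change (removeFirst ε _).elim 0 _ = _
  by_cases h' : ε' = ε
  · subst h'
    rw [removeFirst_cons, if_pos rfl]
    rfl
  · simp [removeFirst, DirPath.cons, h']

open Classical in
theorem adjoint_creation_apply (ε : Γ.DirEdge) (f : Γ.Fock) (q : Γ.DirPath) :
    ContinuousLinearMap.adjoint (creation ε) f q =
      if h : q.src = ε.tgt then f (q.cons ε h) else 0 := by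
  split_ifs with h
  · exact adjoint_pullback_apply_of_eq_some _ _ f (removeFirst_cons ε q h)
  · exact adjoint_pullback_apply_of_forall_ne _ _ f fun i hi => h (src_of_removeFirst hi)

open Classical in
theorem vertexProj_apply (v : V) (f : Γ.Fock) (q : Γ.DirPath) :
    Γ.vertexProj v f q = if q.src = v then f q else 0 := by
  change (restrictSrc v q).elim 0 _ = _
  by_cases h : q.src = v <;> simp [restrictSrc, h]

theorem adjoint_vertexProj (v : V) :
    ContinuousLinearMap.adjoint (Γ.vertexProj v) = Γ.vertexProj v := by
  ext f q
  rw [vertexProj_apply]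
  split_ifs with h
  · exact adjoint_pullback_apply_of_eq_some _ _ f (by simp [restrictSrc, h])
  · refine adjoint_pullback_apply_of_forall_ne _ _ f fun i hi => h ?_
    simp only [restrictSrc, Option.ite_none_right_eq_some, Option.some.injEq] at hi
    exact hi.2 ▸ hi.1

theorem sum_vertexProj [Fintype V] : ∑ v, Γ.vertexProj v = 1 := by
  classical
  ext f q
  have : (∑ v, Γ.vertexProj v) f q = ∑ v, Γ.vertexProj v f q := by
    rw [sum_apply, lp.coeFn_sum, Finset.sum_apply]
  rw [this]
  simp [vertexProj_apply]

theorem condExp_eq_apply (x : Γ.Fock →L[ℂ] Γ.Fock) (v : V) :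
    condExp x v = x (Γ.vertexVec v) (vertexPath v) := by
  classical
  rw [condExp]
  nth_rw 1 [vertexVec]
  rw [lp.inner_single_left]
  simp

theorem eq_vertexPath_iff (q : Γ.DirPath) (v : V) : q = vertexPath v ↔ q.src = v ∧ q.1.2 = [] :=
  Subtype.ext_iff.trans Prod.ext_iff

open Classical in
theorem vertexVec_apply (v : V) (q : Γ.DirPath) :
    Γ.vertexVec v q = if q = vertexPath v then 1 else 0 := by
  rw [vertexVec, lp.single_apply, Pi.single_apply]

variable (Γ) in
/-- The linear span of the creation operators, the annihilation operators and the vertex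
projections. -/
noncomputable def stepSpan : Submodule ℂ (Γ.Fock →L[ℂ] Γ.Fock) :=
  Submodule.span ℂ (Set.range (creation (Γ := Γ)) ∪
    Set.range (fun ε : Γ.DirEdge => ContinuousLinearMap.adjoint (creation ε)) ∪
    Set.range Γ.vertexProj)

theorem creation_mem_stepSpan (ε : Γ.DirEdge) : creation ε ∈ Γ.stepSpan :=
  Submodule.subset_span (Or.inl (Or.inl ⟨ε, rfl⟩))

theorem adjoint_creation_mem_stepSpan (ε : Γ.DirEdge) :
    ContinuousLinearMap.adjoint (creation ε) ∈ Γ.stepSpan :=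
  Submodule.subset_span (Or.inl (Or.inr ⟨ε, rfl⟩))

theorem vertexProj_mem_stepSpan (v : V) : Γ.vertexProj v ∈ Γ.stepSpan :=
  Submodule.subset_span (Or.inr ⟨v, rfl⟩)

theorem exists_coeff_of_mem_stepSpan [Fintype V] [Fintype Γ.DirEdge] {x : Γ.Fock →L[ℂ] Γ.Fock}
    (hx : x ∈ Γ.stepSpan) : ∃ (a b : Γ.DirEdge → ℂ) (c : V → ℂ),
      x = ∑ ε, a ε • creation ε + ∑ ε, b ε • ContinuousLinearMap.adjoint (creation ε) +
        ∑ v, c v • Γ.vertexProj v := by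
  classical
  induction hx using Submodule.span_induction with
  | mem x hx =>
    rcases hx with (⟨ε, rfl⟩ | ⟨ε, rfl⟩) | ⟨v, rfl⟩
    · exact ⟨Pi.single ε 1, 0, 0, by simp [Pi.single_apply, ite_smul]⟩
    · exact ⟨0, Pi.single ε 1, 0, by simp [Pi.single_apply, ite_smul]⟩
    · exact ⟨0, 0, Pi.single v 1, by simp [Pi.single_apply, ite_smul]⟩
  | zero => exact ⟨0, 0, 0, by simp⟩
  | add x y _ _ hx hy =>
    obtain ⟨a, b, c, rfl⟩ := hx
    obtain ⟨a', b', c', rfl⟩ := hy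
    refine ⟨a + a', b + b', c + c', ?_⟩
    simp only [Pi.add_apply, add_smul, Finset.sum_add_distrib]
    abel
  | smul r x _ hx =>
    obtain ⟨a, b, c, rfl⟩ := hx
    exact ⟨r • a, r • b, r • c, by simp [smul_add, Finset.smul_sum, smul_smul]⟩

instance [Finite V] [Finite E] : Finite Γ.DirEdge :=
  Finite.of_injective (fun ε : Γ.DirEdge => (ε.edge, ε.src, ε.tgt)) fun ε ε' h => by
    cases ε; cases ε'
    simp only [Prod.mk.injEq] at h
    obtain ⟨rfl, rfl, rfl⟩ := h
    rfl

end Operators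

end WeightedGraph

/-! ### Return series of a matrix-valued walk on paths -/

namespace WeightedGraph

variable {V E : Type*} {Γ : WeightedGraph V E}

section FirstReturn

open scoped PowerSeries Polynomial Classical

variable [Fintype V] [Fintype Γ.DirEdge] {N : Type*} [Fintype N] [DecidableEq N]
  (a b : Γ.DirEdge → Matrix N N ℂ) (c : V → Matrix N N ℂ)

/-- The first-return operator at `s` of a step with creation coefficients `a`, annihilation
coefficients `b` and diagonal coefficients `c`, expressed through the full return series `H`. -/
noncomputable def firstReturn (H : V → Matrix N N ℂ⟦X⟧) (s : V) : Matrix N N ℂ⟦X⟧ :=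
  (c s).map PowerSeries.C + (PowerSeries.X : ℂ⟦X⟧) • ∑ ε : Γ.DirEdge,
    if ε.tgt = s then (b ε).map PowerSeries.C * H ε.src * (a ε).map PowerSeries.C else 0

-- The unknown `H` enters the right-hand side only behind a factor `X`, which makes it an `X`-adic
-- contraction.
omit [Fintype V] in
theorem exists_eq_one_add_firstReturn : ∃ H : V → Matrix N N ℂ⟦X⟧,
    ∀ s, H s = 1 + (PowerSeries.X : ℂ⟦X⟧) • (firstReturn a b c H s * H s) := by
  let mat : (V × N × N → ℂ⟦X⟧) → V → Matrix N N ℂ⟦X⟧ := fun u s => Matrix.of fun i j => u (s, i, j)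
  obtain ⟨u, hu⟩ := PowerSeries.exists_fixedPoint (ι := V × N × N)
    (fun u p => (1 + (PowerSeries.X : ℂ⟦X⟧) • (firstReturn a b c (mat u) p.1 * mat u p.1))
      p.2.1 p.2.2) (by
    rintro m u w huw ⟨s, i, j⟩
    let I : Ideal ℂ⟦X⟧ := Ideal.span {PowerSeries.X ^ m}
    -- Congruence modulo `X ^ m` is equality after a ring homomorphism, so it passes through all
    -- sums and matrix products at once.
    let ψ := (Ideal.Quotient.mk I).mapMatrix (m := N)
    have h1 : ∀ s, ψ (mat u s) = ψ (mat w s) := by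
      intro s
      ext1 i j
      exact Ideal.Quotient.eq.2 (Ideal.mem_span_singleton.2 (huw (s, i, j)))
    have hX : ∀ M : Matrix N N ℂ⟦X⟧, ψ ((PowerSeries.X : ℂ⟦X⟧) • M) =
        Ideal.Quotient.mk I PowerSeries.X • ψ M := by
      intro M
      ext1 i j
      simp [ψ]
    have h2 : ψ (firstReturn a b c (mat u) s * mat u s) =
        ψ (firstReturn a b c (mat w) s * mat w s) := by
      rw [map_mul, map_mul, h1, firstReturn, firstReturn, map_add, map_add, hX, hX, map_sum, map_sum]
      congr 4
      funext ε
      split_ifs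
      · rw [map_mul, map_mul, map_mul, map_mul, h1]
      · rfl
    have h3 : PowerSeries.X ^ m ∣ (firstReturn a b c (mat u) s * mat u s) i j -
        (firstReturn a b c (mat w) s * mat w s) i j :=
      Ideal.mem_span_singleton.1 (Ideal.Quotient.eq.1 (congrFun (congrFun h2 i) j))
    simp only [Matrix.add_apply, Matrix.smul_apply, smul_eq_mul, add_sub_add_left_eq_sub, ← mul_sub]
    rw [pow_succ']
    exact mul_dvd_mul_left _ h3)
  refine ⟨mat u, fun s => ?_⟩
  ext1 i j
  exact (congrFun hu (s, i, j)).symm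

theorem isAlgebraic_of_eq_one_add_firstReturn (H : V → Matrix N N ℂ⟦X⟧)
    (hH : ∀ s, H s = 1 + (PowerSeries.X : ℂ⟦X⟧) • (firstReturn a b c H s * H s)) (s : V) (i j : N) :
    IsAlgebraic ℂ[X] (H s i j) := by
  let u : V × N × N → ℂ⟦X⟧ := fun p => H p.1 p.2.1 p.2.2
  refine PowerSeries.isAlgebraic_of_system u
    (fun p => (firstReturn a b c H p.1 * H p.1) p.2.1 p.2.2)
    (fun p => if p.2.1 = p.2.2 then 1 else 0) ?_ ?_ (s, i, j)
  · rintro ⟨s, i, j⟩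
    have hHm : ∀ s i j, H s i j ∈ Algebra.adjoin ℂ[X] (Set.range u) := fun s i j =>
      Algebra.subset_adjoin ⟨(s, i, j), rfl⟩
    have hC : ∀ r : ℂ, PowerSeries.C r ∈ Algebra.adjoin ℂ[X] (Set.range u) := fun r => by
      rw [← Polynomial.coe_C]
      exact Subalgebra.algebraMap_mem _ (Polynomial.C r)
    have hX : (PowerSeries.X : ℂ⟦X⟧) ∈ Algebra.adjoin ℂ[X] (Set.range u) := by
      rw [← Polynomial.coe_X]
      exact Subalgebra.algebraMap_mem _ Polynomial.X
    simp only [Matrix.mul_apply, firstReturn, Matrix.add_apply, Matrix.smul_apply, Matrix.map_apply,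
      Matrix.sum_apply, smul_eq_mul]
    refine sum_mem fun l _ => mul_mem (add_mem (hC _) (mul_mem hX (sum_mem fun ε _ => ?_)))
      (hHm _ _ _)
    split_ifs
    · simp only [Matrix.mul_apply, Matrix.map_apply]
      exact sum_mem fun _ _ => mul_mem (sum_mem fun _ _ => mul_mem (hC _) (hHm _ _ _)) (hC _)
    · exact zero_mem _
  · rintro ⟨s, i, j⟩
    change H s i j = _
    conv_lhs => rw [hH s]
    by_cases hij : i = j <;> simp [hij]

variable (H : V → Matrix N N ℂ⟦X⟧)

/-- The generating series of the walks from the path of length zero at `v` to a path with source `s`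
and edges `l`, expressed through the return series `H`. -/
noncomputable def walkSeries (v : V) : V → List Γ.DirEdge → Matrix N N ℂ⟦X⟧
  | s, [] => if s = v then H v else 0
  | s, ε :: l => H s * ((PowerSeries.X : ℂ⟦X⟧) • ((a ε).map PowerSeries.C * walkSeries v ε.tgt l))

/-- The contribution to `walkSeries` of the walks whose last step creates the first edge. -/
noncomputable def creationSeries (v : V) : List Γ.DirEdge → Matrix N N ℂ⟦X⟧
  | [] => 0
  | ε :: l => (a ε).map PowerSeries.C * walkSeries a H v ε.tgt l

-- Classification of a walk by its last step: creation, staying put, or annihilation. By the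
-- definition of `walkSeries`, the last two add up to `firstReturn * walkSeries`, after which the
-- claim is the equation for `H`, multiplied on the right when `l` is nonempty.
omit [Fintype V] in
theorem walkSeries_eq (hH : ∀ s, H s = 1 + (PowerSeries.X : ℂ⟦X⟧) • (firstReturn a b c H s * H s))
    (v s : V) (l : List Γ.DirEdge) :
    walkSeries a H v s l = (if s = v ∧ l = [] then 1 else 0) + (PowerSeries.X : ℂ⟦X⟧) •
      (creationSeries a H v l + (c s).map PowerSeries.C * walkSeries a H v s l +
        ∑ ε : Γ.DirEdge, if ε.tgt = s then
          (b ε).map PowerSeries.C * walkSeries a H v ε.src (ε :: l) else 0) := by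
  have h1 : (c s).map PowerSeries.C * walkSeries a H v s l + (∑ ε : Γ.DirEdge, if ε.tgt = s then
      (b ε).map PowerSeries.C * walkSeries a H v ε.src (ε :: l) else 0) =
      firstReturn a b c H s * walkSeries a H v s l := by
    rw [firstReturn, add_mul, smul_mul_assoc, Finset.sum_mul, Finset.smul_sum]
    congr 1
    refine Finset.sum_congr rfl fun ε _ => ?_
    split_ifs with h
    · rw [walkSeries, h]
      simp only [mul_smul_comm, mul_assoc]
    · simp
  rw [add_assoc, h1]
  cases l with
  | nil =>
    simp only [walkSeries, creationSeries, and_true, zero_add]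
    split_ifs with h
    · subst h
      exact hH s
    · simp
  | cons ε l =>
    simp only [walkSeries, creationSeries, reduceCtorEq, and_false, if_false, zero_add]
    conv_lhs => rw [hH s]
    simp only [add_mul, one_mul, smul_add, smul_mul_assoc, mul_assoc, mul_smul_comm]

omit [DecidableEq N] in
theorem coeff_map_C_mul (k : ℕ) (A : Matrix N N ℂ) (M : Matrix N N ℂ⟦X⟧) (i j : N) :
    PowerSeries.coeff k ((A.map PowerSeries.C * M) i j) =
      ∑ l, A i l * PowerSeries.coeff k (M l j) := by
  simp [Matrix.mul_apply]

variable (Y : Matrix N N (Γ.Fock →L[ℂ] Γ.Fock))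

/-- Both sides satisfy the same one-step recursion in `k`: applying `Y` once more is appending a
last step to the walk. The factor `X` in `walkSeries_eq` counts that step. -/
theorem pow_apply_vertexVec (hY : ∀ i j, Y i j = ∑ ε, a ε i j • creation ε +
      ∑ ε, b ε i j • ContinuousLinearMap.adjoint (creation ε) + ∑ v, c v i j • Γ.vertexProj v)
    (hH : ∀ s, H s = 1 + (PowerSeries.X : ℂ⟦X⟧) • (firstReturn a b c H s * H s)) (v : V) (j : N)
    (k : ℕ) (i : N) (q : Γ.DirPath) :
    (Y ^ k) i j (Γ.vertexVec v) q = PowerSeries.coeff k (walkSeries a H v q.src q.1.2 i j) := by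
  induction k generalizing i q with
  | zero =>
    rw [walkSeries_eq a b c H hH, pow_zero, Matrix.add_apply, Matrix.smul_apply, smul_eq_mul,
      map_add, PowerSeries.coeff_zero_X_mul, add_zero]
    simp only [← eq_vertexPath_iff]
    by_cases hij : i = j
    · subst hij
      rw [Matrix.one_apply_eq, one_apply_eq_self, vertexVec_apply]
      split_ifs <;> simp
    · rw [Matrix.one_apply_ne hij]
      split_ifs
      · simp [Matrix.one_apply_ne hij]
      · simp
  | succ k ih =>
    have h0 : PowerSeries.coeff (k + 1)
        ((if q.src = v ∧ q.1.2 = [] then 1 else 0 : Matrix N N ℂ⟦X⟧) i j) = 0 := by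
      split_ifs
      · by_cases hij : i = j <;> simp [Matrix.one_apply, hij, PowerSeries.coeff_one]
      · simp
    have h1 : ∀ f : Γ.Fock, ∀ m, Y i m f q =
        ∑ ε, a ε i m * creation ε f q +
        ∑ ε, b ε i m * ContinuousLinearMap.adjoint (creation ε) f q +
        ∑ v, c v i m * Γ.vertexProj v f q := by
      intro f m
      rw [hY]
      simp only [add_apply, sum_apply, lp.coeFn_add, lp.coeFn_sum,
        Pi.add_apply, Finset.sum_apply, smul_apply, lp.coeFn_smul, Pi.smul_apply,
        smul_eq_mul]
    rw [pow_succ', Matrix.mul_apply, sum_apply, lp.coeFn_sum, Finset.sum_apply,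
      walkSeries_eq a b c H hH]
    simp only [Matrix.add_apply, Matrix.smul_apply, smul_eq_mul, map_add, h0, zero_add,
      PowerSeries.coeff_succ_X_mul, mul_apply_eq_comp, h1, Finset.sum_add_distrib]
    rw [add_right_comm]
    congr 2
    · rcases q.eq_vertexPath_or_eq_cons with ⟨s, rfl⟩ | ⟨ε, q, h, rfl⟩
      · simp only [creation_apply_vertexPath, mul_zero, Finset.sum_const_zero]
        exact (map_zero _).symm
      · simp only [creation_apply_cons, ih, mul_ite, mul_zero, Finset.sum_ite_eq, Finset.mem_univ,
          if_true, h]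
        exact (coeff_map_C_mul k _ _ i j).symm
    · simp only [coeff_map_C_mul, vertexProj_apply, ih, mul_ite, mul_zero, Finset.sum_ite_eq,
        Finset.mem_univ, if_true]
    · rw [Matrix.sum_apply, map_sum, Finset.sum_comm]
      refine Finset.sum_congr rfl fun ε _ => ?_
      simp only [adjoint_creation_apply, ih]
      by_cases h : q.src = ε.tgt
      · simp only [h, dif_pos, if_true, coeff_map_C_mul]
        rfl
      · simp [h, Ne.symm h]

end FirstReturn

open scoped PowerSeries Polynomial in
theorem isAlgebraic_condExp_of_mem_stepSpan [Fintype V] [Finite E] {N : Type*} [Fintype N]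
    [DecidableEq N] (Y : Matrix N N (Γ.Fock →L[ℂ] Γ.Fock)) (hY : ∀ i j, Y i j ∈ Γ.stepSpan)
    (i j : N) (v : V) :
    IsAlgebraic ℂ[X] (PowerSeries.mk fun k => condExp ((Y ^ k) i j) v) := by
  classical
  have := Fintype.ofFinite Γ.DirEdge
  choose a b c h using fun i j => exists_coeff_of_mem_stepSpan (hY i j)
  obtain ⟨H, hH⟩ := exists_eq_one_add_firstReturn (fun ε => Matrix.of fun i j => a i j ε)
    (fun ε => Matrix.of fun i j => b i j ε) (fun v => Matrix.of fun i j => c i j v)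
  have h1 : (PowerSeries.mk fun k => condExp ((Y ^ k) i j) v) = H v i j := by
    ext k
    rw [PowerSeries.coeff_mk, condExp_eq_apply]
    have := pow_apply_vertexVec _ _ _ H Y h hH v j k i (vertexPath v)
    have hw : ∀ a, walkSeries a H v (vertexPath v : Γ.DirPath).src
        (vertexPath v : Γ.DirPath).1.2 = H v := fun a => if_pos rfl
    have h2 := this.trans (congrArg (fun M => PowerSeries.coeff k (M i j)) (hw _))
    exact h2
  rw [h1]
  exact isAlgebraic_of_eq_one_add_firstReturn _ _ _ H hH v i j

end WeightedGraph

/-! ### Linearisation: reduction to matrices of degree one -/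

theorem Matrix.exists_eq_mul_of_forall_mem_mul {A N : Type*} [Ring A] [Algebra ℂ A] [Fintype N]
    [DecidableEq N] (S T : Submodule ℂ A) (x : Matrix N N A) (hx : ∀ i j, x i j ∈ S * T) :
    ∃ (m : N × N → ℕ) (a : Matrix N (Σ p, Fin (m p)) A) (b : Matrix (Σ p, Fin (m p)) N A),
      (∀ i j, a i j ∈ S) ∧ (∀ i j, b i j ∈ T) ∧ x = a * b := by
  have key : ∀ y ∈ S * T, ∃ (m : ℕ) (p q : Fin m → A), (∀ i, p i ∈ S) ∧ (∀ i, q i ∈ T) ∧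
      y = ∑ i, p i * q i := by
    intro y hy
    induction hy using Submodule.mul_induction_on' with
    | mem_mul_mem s hs t ht => exact ⟨1, fun _ => s, fun _ => t, fun _ => hs, fun _ => ht, by simp⟩
    | add y _ z _ hy hz =>
      obtain ⟨m, p, q, hp, hq, rfl⟩ := hy
      obtain ⟨m', p', q', hp', hq', rfl⟩ := hz
      refine ⟨m + m', Fin.append p p', Fin.append q q', ?_, ?_, by simp [Fin.sum_univ_add]⟩
      · intro i
        refine Fin.addCases (fun i => ?_) (fun i => ?_) i
        · simpa using hp i
        · simpa using hp' i
      · intro i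
        refine Fin.addCases (fun i => ?_) (fun i => ?_) i
        · simpa using hq i
        · simpa using hq' i
  choose m p q hp hq h using fun r : N × N => key (x r.1 r.2) (hx r.1 r.2)
  -- The inner index set has a separate block for every entry of `x`, so that the sums representing
  -- different entries do not mix.
  refine ⟨m, Matrix.of fun i r => if i = r.1.1 then p r.1 r.2 else 0,
    Matrix.of fun r j => if j = r.1.2 then q r.1 r.2 else 0, fun i r => ?_, fun r j => ?_, ?_⟩
  · simp only [Matrix.of_apply]
    split_ifs
    · exact hp _ _
    · exact zero_mem _
  · simp only [Matrix.of_apply]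
    split_ifs
    · exact hq _ _
    · exact zero_mem _
  · ext1 i j
    rw [h (i, j), Matrix.mul_apply, Fintype.sum_sigma, Finset.sum_eq_single (i, j)]
    · simp
    · rintro ⟨i', j'⟩ _ hne
      refine Finset.sum_eq_zero fun l _ => ?_
      by_cases hi : i = i'
      · have hj : j ≠ j' := fun hj => hne (by rw [hi, hj])
        simp [hj]
      · simp [hi]
    · simp

theorem Matrix.fromBlocks_zero_pow {A m n : Type*} [Ring A] [Fintype m] [Fintype n] [DecidableEq m]
    [DecidableEq n] (a : Matrix m n A) (b : Matrix n m A) (k : ℕ) :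
    Matrix.fromBlocks 0 a b 0 ^ (2 * k) = Matrix.fromBlocks ((a * b) ^ k) 0 0 ((b * a) ^ k) := by
  rw [pow_mul, pow_two, Matrix.fromBlocks_multiply]
  simp [Matrix.fromBlocks_diagonal_pow]

theorem Submodule.pow_mono_of_one_mem {A : Type*} [Ring A] [Algebra ℂ A] {S : Submodule ℂ A}
    (h1 : 1 ∈ S) {d d' : ℕ} (h : d ≤ d') : S ^ d ≤ S ^ d' :=
  pow_le_pow_right' (Submodule.one_le.2 h1) h

/-- The adjoint is tracked together with the element, since the induction over the generated
`*`-algebra has a case for `star`. -/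
theorem StarAlgebra.exists_mem_pow_of_mem_adjoin {A : Type*} [Ring A] [StarRing A] [Algebra ℂ A]
    [StarModule ℂ A] (S : Submodule ℂ A) (h1 : 1 ∈ S) (G : Set A)
    (hG : ∀ x ∈ G, x ∈ S ∧ star x ∈ S) {x : A} (hx : x ∈ StarAlgebra.adjoin ℂ G) :
    ∃ d, x ∈ S ^ d ∧ star x ∈ S ^ d := by
  induction hx using StarAlgebra.adjoin_induction with
  | mem x hx => exact ⟨1, by simpa using hG x hx⟩
  | algebraMap r =>
    refine ⟨0, ?_, ?_⟩
    · rw [pow_zero]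
      exact Submodule.algebraMap_mem r
    · rw [pow_zero, ← algebraMap_star_comm]
      exact Submodule.algebraMap_mem _
  | add x y _ _ hx hy =>
    obtain ⟨d, h, h'⟩ := hx
    obtain ⟨e, k, k'⟩ := hy
    have hd := Submodule.pow_mono_of_one_mem h1 (le_max_left d e)
    have he := Submodule.pow_mono_of_one_mem h1 (le_max_right d e)
    exact ⟨max d e, add_mem (hd h) (he k), by rw [star_add]; exact add_mem (hd h') (he k')⟩
  | mul x y _ _ hx hy =>
    obtain ⟨d, h, h'⟩ := hx
    obtain ⟨e, k, k'⟩ := hy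
    refine ⟨d + e, ?_, ?_⟩
    · rw [pow_add]
      exact Submodule.mul_mem_mul h k
    · rw [star_mul, add_comm, pow_add]
      exact Submodule.mul_mem_mul k' h'
  | star x _ hx =>
    obtain ⟨d, h, h'⟩ := hx
    exact ⟨d, h', by rwa [star_star]⟩

namespace WeightedGraph

variable {V E : Type*} {Γ : WeightedGraph V E}

section Algebraicity

open scoped PowerSeries Polynomial

/-- Halving of the degree at the cost of a larger matrix: `Y = a * b` is replaced by the block
matrix with off-diagonal blocks `a`, `b`, whose upper left corner has the moments of `Y` in even
degrees and zero in odd degrees. -/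
theorem isAlgebraic_condExp_of_mem_stepSpan_pow [Fintype V] [Finite E] (e : ℕ) {N : Type}
    [Fintype N] [DecidableEq N] (Y : Matrix N N (Γ.Fock →L[ℂ] Γ.Fock))
    (hY : ∀ i j, Y i j ∈ Γ.stepSpan ^ 2 ^ e) (i j : N) (v : V) :
    IsAlgebraic ℂ[X] (PowerSeries.mk fun k => condExp ((Y ^ k) i j) v) := by
  induction e generalizing N with
  | zero => exact isAlgebraic_condExp_of_mem_stepSpan Y (by simpa using hY) i j v
  | succ e ih =>
    simp only [pow_succ, mul_two, pow_add] at hY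
    obtain ⟨m, a, b, ha, hb, rfl⟩ := Matrix.exists_eq_mul_of_forall_mem_mul _ _ Y hY
    refine PowerSeries.isAlgebraic_of_even _ _ (fun k => ?_) (fun k => ?_)
      (ih (Matrix.fromBlocks 0 a b 0) ?_ (Sum.inl i) (Sum.inl j))
    · rw [PowerSeries.coeff_mk, PowerSeries.coeff_mk, Matrix.fromBlocks_zero_pow]
      rfl
    · rw [PowerSeries.coeff_mk, pow_succ, Matrix.fromBlocks_zero_pow, Matrix.fromBlocks_multiply]
      simp [condExp]
    · rintro (i | i) (j | j)
      · exact zero_mem _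
      · exact ha i j
      · exact hb i j
      · exact zero_mem _

theorem one_mem_stepSpan [Fintype V] : (1 : Γ.Fock →L[ℂ] Γ.Fock) ∈ Γ.stepSpan := by
  rw [← sum_vertexProj]
  exact sum_mem fun v _ => vertexProj_mem_stepSpan v

theorem edgeOp_mem_stepSpan (ε : Γ.DirEdge) : edgeOp ε ∈ Γ.stepSpan :=
  add_mem (Submodule.smul_mem _ _ (creation_mem_stepSpan _))
    (Submodule.smul_mem _ _ (adjoint_creation_mem_stepSpan _))

theorem star_edgeOp_mem_stepSpan (ε : Γ.DirEdge) : star (edgeOp ε) ∈ Γ.stepSpan := by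
  rw [edgeOp, star_add, star_smul, star_smul, ContinuousLinearMap.star_eq_adjoint,
    ContinuousLinearMap.star_eq_adjoint, ContinuousLinearMap.adjoint_adjoint]
  exact add_mem (Submodule.smul_mem _ _ (adjoint_creation_mem_stepSpan _))
    (Submodule.smul_mem _ _ (creation_mem_stepSpan _))

theorem exists_mem_stepSpan_pow [Fintype V] {x : Γ.Fock →L[ℂ] Γ.Fock} (hx : x ∈ Γ.graphAlgebra) :
    ∃ d, x ∈ Γ.stepSpan ^ d := by
  obtain ⟨d, hd, _⟩ := StarAlgebra.exists_mem_pow_of_mem_adjoin Γ.stepSpan one_mem_stepSpan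
    (Set.range Γ.vertexProj ∪ Set.range (edgeOp (Γ := Γ))) (by
      rintro _ (⟨v, rfl⟩ | ⟨ε, rfl⟩)
      · refine ⟨vertexProj_mem_stepSpan v, ?_⟩
        rw [ContinuousLinearMap.star_eq_adjoint, adjoint_vertexProj]
        exact vertexProj_mem_stepSpan v
      · exact ⟨edgeOp_mem_stepSpan ε, star_edgeOp_mem_stepSpan ε⟩) hx
  exact ⟨d, hd⟩

theorem isAlgebraic_matrixTrace [Fintype V] [Finite E] {n : ℕ}
    (y : Matrix (Fin n) (Fin n) (Γ.Fock →L[ℂ] Γ.Fock)) (hy : ∀ i j, y i j ∈ Γ.graphAlgebra) :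
    IsAlgebraic ℂ[X] (PowerSeries.mk fun k => matrixTrace (y ^ k)) := by
  choose d hd using fun i j => exists_mem_stepSpan_pow (hy i j)
  obtain ⟨D, hD⟩ : ∃ D, ∀ i j, d i j ≤ D :=
    ⟨∑ i, ∑ j, d i j, fun i j =>
      (Finset.single_le_sum (f := fun j => d i j) (fun _ _ => Nat.zero_le _) (Finset.mem_univ j)).trans
        (Finset.single_le_sum (f := fun i => ∑ j, d i j) (fun _ _ => Nat.zero_le _)
          (Finset.mem_univ i))⟩
  -- The halving needs a common degree that is a power of two. Degrees can be raised because `1` is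
  -- the sum of the vertex projections, and `D < 2 ^ D`.
  have h1 : ∀ i j, y i j ∈ Γ.stepSpan ^ 2 ^ D := fun i j =>
    Submodule.pow_mono_of_one_mem one_mem_stepSpan ((hD i j).trans Nat.lt_two_pow_self.le) (hd i j)
  have hC : ∀ r : ℂ, IsAlgebraic ℂ[X] (PowerSeries.C r : ℂ⟦X⟧) := fun r => by
    rw [← Polynomial.coe_C]
    exact isAlgebraic_algebraMap (Polynomial.C r)
  have h2 : (PowerSeries.mk fun k => matrixTrace (y ^ k)) = PowerSeries.C (n : ℂ)⁻¹ *
      ∑ i, ∑ v, PowerSeries.C (Γ.weight v : ℂ) *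
        PowerSeries.mk fun k => condExp ((y ^ k) i i) v := by
    ext k
    simp [matrixTrace, graphTrace]
  rw [h2]
  refine (hC _).mul ?_
  rw [← Subalgebra.mem_algebraicClosure]
  refine sum_mem fun i _ => sum_mem fun v _ => ?_
  rw [Subalgebra.mem_algebraicClosure]
  exact (hC _).mul (isAlgebraic_condExp_of_mem_stepSpan_pow D y h1 i i v)

end Algebraicity

end WeightedGraph

/-! ### Measures with bounded support: moments and Cauchy transform -/

section Moments

open MeasureTheory

theorem MeasureTheory.ae_mem_Icc_of_measure_compl_eq_zero {μ : Measure ℝ} {K : Set ℝ} {R : ℝ}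
    (hK : K ⊆ Set.Icc (-R) R) (h : μ Kᶜ = 0) : ∀ᵐ t ∂μ, t ∈ Set.Icc (-R) R :=
  measure_mono_null (Set.compl_subset_compl.2 hK) h

theorem MeasureTheory.integrable_of_continuous_of_ae_mem_Icc {μ : Measure ℝ} [IsFiniteMeasure μ]
    {F : Type*} [NormedAddCommGroup F] {R : ℝ} (h : ∀ᵐ t ∂μ, t ∈ Set.Icc (-R) R) {f : ℝ → F}
    (hf : Continuous f) : Integrable f μ := by
  obtain ⟨C, hC⟩ := isCompact_Icc.exists_bound_of_continuousOn (s := Set.Icc (-R) R) hf.continuousOn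
  exact Integrable.of_bound hf.aestronglyMeasurable C (h.mono fun t ht => hC t ht)

/-- By the Weierstrass theorem polynomials are uniformly dense on the interval, so the moments
determine the integrals of all continuous functions. -/
theorem MeasureTheory.Measure.eq_of_moments_eq {μ ν : Measure ℝ} [IsFiniteMeasure μ]
    [IsFiniteMeasure ν] {R : ℝ} (hμ : ∀ᵐ t ∂μ, t ∈ Set.Icc (-R) R)
    (hν : ∀ᵐ t ∂ν, t ∈ Set.Icc (-R) R) (h : ∀ k : ℕ, ∫ t, t ^ k ∂μ = ∫ t, t ^ k ∂ν) : μ = ν := by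
  have hpoly : ∀ p : Polynomial ℝ, ∫ t, p.eval t ∂μ = ∫ t, p.eval t ∂ν := by
    intro p
    simp only [Polynomial.eval_eq_sum_range]
    rw [integral_finsetSum, integral_finsetSum]
    · simp only [integral_const_mul, h]
    · exact fun k _ => integrable_of_continuous_of_ae_mem_Icc hν (by fun_prop)
    · exact fun k _ => integrable_of_continuous_of_ae_mem_Icc hμ (by fun_prop)
  have hclose : ∀ (ρ : Measure ℝ) [IsFiniteMeasure ρ], (∀ᵐ t ∂ρ, t ∈ Set.Icc (-R) R) →
      ∀ (f : ℝ → ℝ), Continuous f → ∀ (p : Polynomial ℝ) (δ : ℝ),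
      (∀ t ∈ Set.Icc (-R) R, |p.eval t - f t| < δ) →
      |∫ t, p.eval t ∂ρ - ∫ t, f t ∂ρ| ≤ δ * ρ.real Set.univ := by
    intro ρ _ hρ f hf p δ hp
    rw [← integral_sub (integrable_of_continuous_of_ae_mem_Icc hρ p.continuous)
      (integrable_of_continuous_of_ae_mem_Icc hρ hf), ← Real.norm_eq_abs]
    exact norm_integral_le_of_norm_le_const (hρ.mono fun t ht => (hp t ht).le)
  refine ext_of_forall_integral_eq_of_IsFiniteMeasure fun f => ?_
  refine eq_of_abs_sub_le_all fun ε hε => ?_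
  -- The tolerance `ε / C` is paid once per unit of mass of each measure; the summand `1` keeps `C`
  -- positive when both measures vanish.
  set C := μ.real Set.univ + ν.real Set.univ + 1 with hC
  have hμ0 : 0 ≤ μ.real Set.univ := measureReal_nonneg
  have hν0 : 0 ≤ ν.real Set.univ := measureReal_nonneg
  have hC0 : 0 < C := by positivity
  obtain ⟨p, hp⟩ := exists_polynomial_near_of_continuousOn (-R) R f f.continuous.continuousOn (ε / C)
    (by positivity)
  have e1 := hclose μ hμ f f.continuous p _ hp
  have e2 := hclose ν hν f f.continuous p _ hp
  rw [hpoly p] at e1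
  have e3 : ε / C * μ.real Set.univ + ε / C * ν.real Set.univ ≤ ε := by
    rw [← mul_add, div_mul_eq_mul_div, div_le_iff₀ hC0]
    exact mul_le_mul_of_nonneg_left (by linarith) hε.le
  rw [abs_le] at e1 e2 ⊢
  constructor <;> linarith [e1.1, e1.2, e2.1, e2.2]

theorem hasSum_cauchyTransform {ν : Measure ℝ} [IsFiniteMeasure ν] {R : ℝ}
    (hν : ∀ᵐ t ∂ν, t ∈ Set.Icc (-R) R) {z : ℂ} (hz : R < ‖z‖) :
    HasSum (fun k : ℕ => ((∫ t, t ^ k ∂ν : ℝ) : ℂ) * z⁻¹ ^ (k + 1)) (cauchyTransform ν z) := by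
  -- Only a nonzero measure forces `0 ≤ R`.
  rcases eq_zero_or_neZero ν with rfl | hne
  · simp [cauchyTransform]
  have hR : 0 ≤ R := by
    obtain ⟨t, ht⟩ := hν.exists
    linarith [ht.1, ht.2]
  have hz0 : 0 < ‖z‖ := hR.trans_lt hz
  have hz' : z ≠ 0 := norm_pos_iff.1 hz0
  have hlt : R * ‖z‖⁻¹ < 1 := by rwa [← div_eq_mul_inv, div_lt_one hz0]
  let F : ℕ → ℝ → ℂ := fun k t => ((t ^ k : ℝ) : ℂ) * z⁻¹ ^ (k + 1)
  have hcont : ∀ k, Continuous (F k) := fun k => by fun_prop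
  have hbound : ∀ k, ∀ t ∈ Set.Icc (-R) R, ‖F k t‖ ≤ (R * ‖z‖⁻¹) ^ k * ‖z‖⁻¹ := by
    intro k t ht
    simp only [F, norm_mul, norm_pow, norm_inv, Complex.norm_real, Real.norm_eq_abs]
    rw [mul_pow, pow_succ, ← mul_assoc]
    gcongr
    exact abs_le.2 ht
  have h1 : HasSum (fun k => ∫ t, F k t ∂ν) (∫ t, ∑' k, F k t ∂ν) := by
    refine hasSum_integral_of_summable_integral_norm
      (fun k => integrable_of_continuous_of_ae_mem_Icc hν (hcont k)) ?_
    refine Summable.of_nonneg_of_le (fun k => integral_nonneg fun t => norm_nonneg _) (fun k => ?_)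
      (((summable_geometric_of_lt_one (by positivity) hlt).mul_right ‖z‖⁻¹).mul_right
        (ν.real Set.univ))
    refine (le_abs_self _).trans ?_
    rw [← Real.norm_eq_abs]
    exact norm_integral_le_of_norm_le_const (hν.mono fun t ht => by simpa using hbound k t ht)
  have h2 : ∫ t, ∑' k, F k t ∂ν = cauchyTransform ν z := by
    refine integral_congr_ae (hν.mono fun t ht => ?_)
    have hlt' : ‖(t : ℂ) * z⁻¹‖ < 1 := by
      rw [norm_mul, norm_inv, Complex.norm_real, Real.norm_eq_abs]
      exact (mul_le_mul_of_nonneg_right (abs_le.2 ht) (by positivity)).trans_lt hlt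
    have hg := (hasSum_geometric_of_norm_lt_one hlt').mul_right z⁻¹
    have : ∑' k, F k t = (1 - (t : ℂ) * z⁻¹)⁻¹ * z⁻¹ := by
      rw [← hg.tsum_eq]
      refine tsum_congr fun k => ?_
      simp only [F]
      push_cast
      ring
    refine this.trans ?_
    rw [← mul_inv]
    congr 1
    field_simp
  rw [h2] at h1
  convert! h1 using 2 with k
  simp only [F]
  rw [integral_mul_const]
  congr 1
  exact integral_complex_ofReal.symm

end Moments

/-! ### The spectral measure of a self-adjoint element under a positive functional -/

section SpectralMeasure

open MeasureTheory

/-- Composing `τ` with the continuous functional calculus gives a positive functional on the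
continuous functions on the compact spectrum, which Riesz–Markov represents by a measure. Positivity
holds since `f ≥ 0` is the square of `√f`. -/
theorem exists_measure_moments_eq_of_isSelfAdjoint {A : Type*} [CStarAlgebra A] {a : A}
    (ha : IsSelfAdjoint a) (τ : A →ₗ[ℂ] ℂ) (hτ : ∀ b, 0 ≤ (τ (star b * b)).re) :
    ∃ μ : Measure ℝ, IsFiniteMeasure μ ∧ μ (spectrum ℝ a)ᶜ = 0 ∧
      ∀ k : ℕ, ∫ t, t ^ k ∂μ = (τ (a ^ k)).re := by
  let Φ := cfcHom (R := ℝ) ha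
  let φ : C(spectrum ℝ a, ℝ) →ₗ[ℝ] ℝ :=
    (Complex.reLm.comp (τ.restrictScalars ℝ)).comp Φ.toAlgHom.toLinearMap
  have hφ : ∀ f, φ f = (τ (Φ f)).re := fun _ => rfl
  let Λ : CompactlySupportedContinuousMap (spectrum ℝ a) ℝ →ₚ[ℝ] ℝ := PositiveLinearMap.mk₀
    { toFun := fun f => φ f.toContinuousMap
      map_add' := fun f g => map_add φ f.toContinuousMap g.toContinuousMap
      map_smul' := fun r f => map_smul φ r f.toContinuousMap }
    (fun f hf => by
      let g : C(spectrum ℝ a, ℝ) := ⟨fun t => Real.sqrt (f t), by fun_prop⟩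
      have hfg : f.toContinuousMap = star g * g := by
        ext t
        exact (Real.mul_self_sqrt (hf t)).symm
      change 0 ≤ φ f.toContinuousMap
      rw [hφ, hfg, map_mul, map_star]
      exact hτ _)
  have hK : IsClosed (spectrum ℝ a) := spectrum.isClosed _
  refine ⟨(RealRMK.rieszMeasure Λ).map Subtype.val, Measure.isFiniteMeasure_map _ _, ?_,
    fun k => ?_⟩
  · rw [Measure.map_apply measurable_subtype_coe hK.measurableSet.compl]
    have h2 : (Subtype.val ⁻¹' (spectrum ℝ a)ᶜ : Set (spectrum ℝ a)) = ∅ := by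
      ext t
      simp
    rw [h2, measure_empty]
  · let f : CompactlySupportedContinuousMap (spectrum ℝ a) ℝ :=
      CompactlySupportedContinuousMap.continuousMapEquiv
        ((ContinuousMap.restrict (spectrum ℝ a) (ContinuousMap.id ℝ)) ^ k)
    have h1 : ∫ t, t ^ k ∂((RealRMK.rieszMeasure Λ).map Subtype.val) = Λ f := by
      rw [integral_map measurable_subtype_coe.aemeasurable (by fun_prop),
        ← RealRMK.integral_rieszMeasure]
      rfl
    have h2 : Φ f.toContinuousMap = a ^ k := by
      have : f.toContinuousMap =
        (ContinuousMap.restrict (spectrum ℝ a) (ContinuousMap.id ℝ)) ^ k := rfl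
      rw [this, map_pow]
      congr 1
      exact cfcHom_id ha
    rw [h1, ← h2]
    rfl

end SpectralMeasure

/-! ### Existence, uniqueness and algebraicity of the law -/

namespace WeightedGraph

variable {V E : Type*} {Γ : WeightedGraph V E}

section Law

open MeasureTheory

variable [Fintype V] {n : ℕ}

omit [Fintype V] in
theorem condExp_add (x y : Γ.Fock →L[ℂ] Γ.Fock) (v : V) :
    condExp (x + y) v = condExp x v + condExp y v := by
  simp only [condExp, add_apply, inner_add_right]

omit [Fintype V] in
theorem condExp_smul (r : ℂ) (x : Γ.Fock →L[ℂ] Γ.Fock) (v : V) :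
    condExp (r • x) v = r * condExp x v := by
  simp only [condExp, smul_apply, inner_smul_right]

omit [Fintype V] in
theorem condExp_star (x : Γ.Fock →L[ℂ] Γ.Fock) (v : V) :
    condExp (star x) v = star (condExp x v) := by
  rw [condExp, ContinuousLinearMap.star_eq_adjoint, ContinuousLinearMap.adjoint_inner_right,
    condExp, RCLike.star_def, inner_conj_symm]

omit [Fintype V] in
theorem condExp_star_mul_self_nonneg (x : Γ.Fock →L[ℂ] Γ.Fock) (v : V) :
    0 ≤ (condExp (star x * x) v).re := by
  rw [condExp, ContinuousLinearMap.star_eq_adjoint, mul_apply_eq_comp,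
    ContinuousLinearMap.adjoint_inner_right]
  exact inner_self_nonneg (𝕜 := ℂ)

/-- The functional `Tr ⊗ tr_n` as a complex linear functional. -/
noncomputable def matrixTraceLinear :
    Matrix (Fin n) (Fin n) (Γ.Fock →L[ℂ] Γ.Fock) →ₗ[ℂ] ℂ where
  toFun := matrixTrace
  map_add' x y := by
    simp only [matrixTrace, graphTrace, Matrix.add_apply, condExp_add, mul_add,
      Finset.sum_add_distrib]
  map_smul' r x := by
    simp only [matrixTrace, graphTrace, Matrix.smul_apply, condExp_smul, RingHom.id_apply,
      smul_eq_mul, Finset.mul_sum]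
    refine Finset.sum_congr rfl fun i _ => Finset.sum_congr rfl fun v _ => ?_
    ring

theorem matrixTrace_star (x : Matrix (Fin n) (Fin n) (Γ.Fock →L[ℂ] Γ.Fock)) :
    matrixTrace (star x) = star (matrixTrace x) := by
  simp only [matrixTrace, graphTrace, Matrix.star_apply, condExp_star, star_mul', star_sum]
  simp

theorem matrixTrace_star_mul_self_nonneg (x : Matrix (Fin n) (Fin n) (Γ.Fock →L[ℂ] Γ.Fock)) :
    0 ≤ (matrixTrace (star x * x)).re := by
  have h : ∀ i v, condExp ((star x * x) i i) v = ∑ j, condExp (star (x j i) * x j i) v := by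
    intro i v
    simp only [Matrix.mul_apply, Matrix.star_apply, condExp, sum_apply, inner_sum]
  rw [matrixTrace, show ((n : ℂ)⁻¹) = (((n : ℝ)⁻¹ : ℝ) : ℂ) by push_cast; rfl, Complex.re_ofReal_mul,
    Complex.re_sum]
  refine mul_nonneg (by positivity) (Finset.sum_nonneg fun i _ => ?_)
  rw [graphTrace, Complex.re_sum]
  refine Finset.sum_nonneg fun v _ => ?_
  rw [Complex.re_ofReal_mul, h, Complex.re_sum]
  exact mul_nonneg (Γ.weight_pos v).le
    (Finset.sum_nonneg fun j _ => condExp_star_mul_self_nonneg _ _)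

omit [Fintype V] in
theorem exists_spectrum_subset_Icc (y : Matrix (Fin n) (Fin n) (Γ.Fock →L[ℂ] Γ.Fock)) :
    ∃ R : ℝ, spectrum ℝ y ⊆ Set.Icc (-R) R := by
  -- `CStarMatrix` is the same algebra with its C*-norm, so the spectrum is that of `y`.
  have hc : IsCompact (spectrum ℝ (CStarMatrix.ofMatrix y)) := spectrum.isCompact _
  obtain ⟨R, hR⟩ := hc.isBounded.subset_closedBall 0
  refine ⟨R, fun t ht => ?_⟩
  have := hR ht
  rwa [mem_closedBall_zero_iff, Real.norm_eq_abs, abs_le] at this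

theorem exists_isLaw (y : Matrix (Fin n) (Fin n) (Γ.Fock →L[ℂ] Γ.Fock)) (hy : IsSelfAdjoint y) :
    ∃ ν : Measure ℝ, IsLaw y ν := by
  obtain ⟨ν, h1, h2, h3⟩ := exists_measure_moments_eq_of_isSelfAdjoint
    (A := CStarMatrix (Fin n) (Fin n) (Γ.Fock →L[ℂ] Γ.Fock)) (a := CStarMatrix.ofMatrix y) hy
    matrixTraceLinear matrixTrace_star_mul_self_nonneg
  refine ⟨ν, h1, ?_, fun k => ?_⟩
  -- Both real spectra are read off from the complex spectrum, which the two forms of the matrix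
  -- algebra share.
  · rwa [← spectrum.preimage_algebraMap ℂ] at h2 ⊢
  · rw [h3]
    -- The moments are real because the functional commutes with `star` and `y ^ k` is self-adjoint.
    refine Complex.conj_eq_iff_re.1 ?_
    change star (matrixTrace (y ^ k)) = matrixTrace (y ^ k)
    rw [← matrixTrace_star, (hy.pow k).star_eq]

theorem IsLaw.eq {y : Matrix (Fin n) (Fin n) (Γ.Fock →L[ℂ] Γ.Fock)} {ν ν' : Measure ℝ}
    (h : IsLaw y ν) (h' : IsLaw y ν') : ν = ν' := by
  obtain ⟨R, hR⟩ := exists_spectrum_subset_Icc y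
  have := h.finite
  have := h'.finite
  refine Measure.eq_of_moments_eq (ae_mem_Icc_of_measure_compl_eq_zero hR h.support)
    (ae_mem_Icc_of_measure_compl_eq_zero hR h'.support) fun k => ?_
  exact_mod_cast (h.moment k).trans (h'.moment k).symm

open scoped PowerSeries Polynomial in
theorem IsLaw.hasAlgebraicCauchyTransform {y : Matrix (Fin n) (Fin n) (Γ.Fock →L[ℂ] Γ.Fock)}
    {ν : Measure ℝ} (h : IsLaw y ν)
    (hy : IsAlgebraic ℂ[X] (PowerSeries.mk fun k => matrixTrace (y ^ k))) :
    HasAlgebraicCauchyTransform ν := by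
  obtain ⟨R, hR⟩ := exists_spectrum_subset_Icc y
  have := h.finite
  refine ⟨PowerSeries.X * PowerSeries.mk fun k => matrixTrace (y ^ k), ⟨R, fun z hz => ?_⟩, ?_⟩
  · have h1 := hasSum_cauchyTransform (ae_mem_Icc_of_measure_compl_eq_zero hR h.support) hz
    simp only [h.moment] at h1
    -- The expansion of the Cauchy transform starts at `1/z`, so the constant term of `X * mk _`,
    -- which is zero, is split off.
    rw [← hasSum_nat_add_iff' 1]
    simpa [PowerSeries.coeff_succ_X_mul] using h1
  · refine IsAlgebraic.mul ?_ hy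
    rw [← Polynomial.coe_X]
    exact isAlgebraic_algebraMap (Polynomial.X : ℂ[X])

end Law

end WeightedGraph

theorem mainTheorem3 {V E : Type*} [Fintype V] [Finite E] (Γ : WeightedGraph V E) (n : ℕ)
    (x : Matrix (Fin n) (Fin n) Γ.graphAlgebra) (hx : IsSelfAdjoint x) :
    (∃! ν : MeasureTheory.Measure ℝ,
      WeightedGraph.IsLaw (x.map (fun a => (a : Γ.Fock →L[ℂ] Γ.Fock))) ν) ∧
    ∀ ν : MeasureTheory.Measure ℝ,
      WeightedGraph.IsLaw (x.map (fun a => (a : Γ.Fock →L[ℂ] Γ.Fock))) ν →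
        HasAlgebraicCauchyTransform ν := by
  have hy : IsSelfAdjoint (x.map (fun a => (a : Γ.Fock →L[ℂ] Γ.Fock))) := by
    ext1 i j
    exact congrArg Subtype.val (congrFun (congrFun hx i) j)
  obtain ⟨ν, hν⟩ := WeightedGraph.exists_isLaw _ hy
  exact ⟨⟨ν, hν, fun ν' hν' => hν'.eq hν⟩, fun ν' hν' => hν'.hasAlgebraicCauchyTransform
    (WeightedGraph.isAlgebraic_matrixTrace _ fun i j => (x i j).2)⟩
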